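/- Let $q\in\mathbb{C}$ with $|q|<1$. For $a\in\mathbb{C}$ put $(a;q)_\infty=\prod_{k\ge 0}(1-aq^k)$ and, for integers $n\ge 0$, $(a;q)_n=\prod_{k=0}^{n-1}(1-aq^k)$. All series below converge absolutely, and the following identities hold. (1) For all nonzero $a,b\in\mathbb{C}$ with $|a|,|b|<1$, $$\frac{(q;q)_\infty^3(ab;q)_\infty}{(a;q)_\infty^2(b;q)_\infty^2}=\sum_{n=0}^{\infty}\left\{\frac{n(q/a;q)_na^n}{(b;q)_{n+1}}+\frac{(n+1)(q/b;q)_nb^n}{(a;q)_{n+1}}\right\}.$$ (2) For all nonzero $a\in\mathbb{C}$ with $|a|<1$, $$\sum_{n=0}^{\infty}(2n+1)\frac{(q/a;q)_na^n}{(a;q)_{n+1}}=\frac{(q;q)_\infty^3(a^2;q)_\infty}{(a;q)_\infty^4}.$$ (3) (Jacobi's identity) $$\sum_{n=0}^{\infty}(2n+1)(-1)^nq^{\binom{n+1}{2}}=(q;q)_\infty^3.$$ (4) For all $b\in\mathbb{C}$ with $0<|q|<|b|<1$, $$\sum_{n=-\infty}^{\infty}\frac{nb^n}{1-q^{n+1}/b}=\frac{(q;q)_\infty^4}{(b;q)_\infty^2(q/b;q)_\infty^2}.$$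 (5) If $q\neq 0$, then $$\sum_{n=-\infty}^{\infty}\frac{n(-q)^n}{1+q^{2n+1}}=(q;q^2)_\infty^4\,(q^4;q^4)_\infty^4.$$ -/

import Mathlib

/-- The infinite `q`-shifted factorial `(a; q)_∞ = ∏_{k ≥ 0} (1 - a q^k)`. -/
noncomputable def qPochInf (a q : ℂ) : ℂ := ∏' k : ℕ, (1 - a * q ^ k)

/-- The finite `q`-shifted factorial `(a; q)_n = ∏_{0 ≤ k < n} (1 - a q^k)`, for `n : ℕ`. -/
noncomputable def qPoch (a q : ℂ) (n : ℕ) : ℂ := ∏ k ∈ Finset.range n, (1 - a * q ^ k)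

/-- For `|q| < 1` the product defining `(a; q)_∞` converges (unconditionally). -/
theorem multipliable_qPochInf (a : ℂ) {q : ℂ} (hq : ‖q‖ < 1) :
    Multipliable (fun k : ℕ => 1 - a * q ^ k) := by
  have h : Summable (fun k : ℕ => ‖-(a * q ^ k)‖) := by
    have := (summable_geometric_of_lt_one (norm_nonneg q) hq).mul_left ‖a‖
    simpa [norm_mul, norm_pow] using this
  simpa [sub_eq_add_neg] using multipliable_one_add_of_summable h

/-- The finite factorial is the quotient `(a; q)_∞ / (a q^n; q)_∞` whenever the latter makes
sense. -/
theorem qPoch_eq_div (a : ℂ) {q : ℂ} (hq : ‖q‖ < 1) (n : ℕ)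
    (h : qPochInf (a * q ^ n) q ≠ 0) :
    qPoch a q n = qPochInf a q / qPochInf (a * q ^ n) q := by
  rw [eq_div_iff h]
  have hm : Multipliable (fun k : ℕ => 1 - a * q ^ (k + n)) := by
    refine (multipliable_qPochInf (a * q ^ n) hq).congr fun k => ?_
    rw [pow_add]
    ring
  have key := Multipliable.prod_mul_tprod_nat_mul' (f := fun k : ℕ => 1 - a * q ^ k) hm
  unfold qPochInf qPoch
  rw [← key]
  refine congrArg _ (tprod_congr fun k => ?_)
  rw [pow_add]
  ring

/-!
Write `x_n(a, b) = (q/a; q)_n a^n / (b; q)_{n+1}`, where `(q/a; q)_n a^n = ∏_{k=1}^n (a - q^k)` is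
a polynomial in `a`, so that `a = 0` is allowed. All five identities are cases of
`∑ n x_n(a, b) + ∑ (n + 1) x_n(b, a) = (q; q)_∞³ (ab; q)_∞ / ((a; q)_∞² (b; q)_∞²)`
for `|a|, |b| < 1` (`fullSum_eq`): `a = b` gives the second, `a = b = 0` gives Jacobi's identity,
`ab = q` gives the bilateral series, and replacing `q, b` by `q², -q` in the latter gives the last.

To prove it, call the left-hand side `G(a, b)`, and put `D(a, b) = ∑ x_n(a, b) - ∑ x_n(b, a)`.
Contiguous relations between the terms at `b` and at `bq` (`term_mul_right`, `term_mul_left`) give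
`(1 - b)² D(a, b) = (1 - ab) D(a, bq)`. Iterating, and using continuity at `b = 0`, one gets
`(b; q)_∞² D(a, b) = (ab; q)_∞ D(a, 0)` (`qPochInf_sq_mul_eq`). Since `D(a, a) = 0` trivially, `D`
vanishes identically (`termSum_comm`). Given this, `G` satisfies the same equation in `b`, and it is
symmetric in `a` and `b`; hence `(a; q)_∞² (b; q)_∞² G(a, b) = (ab; q)_∞ G(0, 0)`
(`fullSum_eq_mul_fullSum_zero`). The constant is found at `a = b = q`, where all terms but one
vanish and `G(q, q) = 1 / (1 - q)` (`fullSum_zero`). No division by `q` occurs in this argument,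
so `q = 0` needs no separate treatment.
-/

namespace LambertSeries

/-- The polynomial `∏_{k=1}^{n} (a - q^k)`, which equals `(q/a; q)_n a^n` for `a ≠ 0`. -/
noncomputable def shiftedPow (a q : ℂ) (n : ℕ) : ℂ := ∏ k ∈ Finset.range n, (a - q ^ (k + 1))

/-- The general term `(q/a; q)_n a^n / (b; q)_{n+1}`, extended polynomially to `a = 0`. -/
noncomputable def term (q a b : ℂ) (n : ℕ) : ℂ := shiftedPow a q n / qPoch b q (n + 1)

/-- The sum `∑ (q/a; q)_n a^n / (b; q)_{n+1}`. -/
noncomputable def termSum (q a b : ℂ) : ℂ := ∑' n, term q a b n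

/-- The weighted sum `∑ n (q/a; q)_n a^n / (b; q)_{n+1}`. -/
noncomputable def weightedSum (q a b : ℂ) : ℂ := ∑' n : ℕ, (n : ℂ) * term q a b n

/-- The difference of `∑ (q/a; q)_n a^n / (b; q)_{n+1}` and its mirror image under `a ↔ b`. -/
noncomputable def antiSum (q a b : ℂ) : ℂ := termSum q a b - termSum q b a

/-- The two-variable Lambert-type series
`∑ n (q/a; q)_n a^n / (b; q)_{n+1} + ∑ (n + 1) (q/b; q)_n b^n / (a; q)_{n+1}`. -/
noncomputable def fullSum (q a b : ℂ) : ℂ :=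
  weightedSum q a b + (weightedSum q b a + termSum q b a)

/-! ### Finite products -/

theorem qPoch_succ (a q : ℂ) (n : ℕ) : qPoch a q (n + 1) = qPoch a q n * (1 - a * q ^ n) :=
  Finset.prod_range_succ _ _

theorem qPoch_mul_self (a q : ℂ) (n : ℕ) :
    (1 - a) * qPoch (a * q) q n = qPoch a q (n + 1) := by
  rw [qPoch, qPoch, Finset.prod_range_succ', mul_comm]
  simp [pow_succ', mul_assoc]

theorem shiftedPow_succ (a q : ℂ) (n : ℕ) :
    shiftedPow a q (n + 1) = shiftedPow a q n * (a - q ^ (n + 1)) :=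
  Finset.prod_range_succ _ _

theorem shiftedPow_mul_self (b q : ℂ) (n : ℕ) :
    shiftedPow (b * q) q (n + 1) = q ^ (n + 1) * (b - 1) * shiftedPow b q n := by
  induction n with
  | zero => simp [shiftedPow]; ring
  | succ n ih => rw [shiftedPow_succ, ih, shiftedPow_succ]; ring

theorem shiftedPow_eq {a : ℂ} (ha : a ≠ 0) (q : ℂ) (n : ℕ) :
    qPoch (q / a) q n * a ^ n = shiftedPow a q n := by
  induction n with
  | zero => simp [shiftedPow, qPoch]
  | succ n ih =>
    rw [shiftedPow_succ, ← ih, qPoch_succ]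
    field_simp
    ring

theorem shiftedPow_zero_left (q : ℂ) (n : ℕ) :
    shiftedPow 0 q n = (-1) ^ n * q ^ Nat.choose (n + 1) 2 := by
  induction n with
  | zero => simp [shiftedPow]
  | succ n ih =>
    rw [shiftedPow_succ, ih, Nat.choose_succ_succ' (n + 1) 1, Nat.choose_one_right, pow_add]
    ring

theorem norm_mul_pow_lt_one {q a : ℂ} (hq : ‖q‖ < 1) (ha : ‖a‖ < 1) (n : ℕ) :
    ‖a * q ^ n‖ < 1 := by
  rw [norm_mul, norm_pow]
  exact (mul_le_of_le_one_right (norm_nonneg a) (pow_le_one₀ (norm_nonneg q) hq.le)).trans_lt ha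

theorem one_sub_ne_zero_of_norm_lt {z : ℂ} (hz : ‖z‖ < 1) : 1 - z ≠ 0 := by
  intro h
  rw [← sub_eq_zero.1 h] at hz
  simp at hz

theorem one_sub_mul_pow_ne_zero {q a : ℂ} (hq : ‖q‖ < 1) (ha : ‖a‖ < 1) (n : ℕ) :
    1 - a * q ^ n ≠ 0 :=
  one_sub_ne_zero_of_norm_lt (norm_mul_pow_lt_one hq ha n)

theorem qPoch_ne_zero {q a : ℂ} (hq : ‖q‖ < 1) (ha : ‖a‖ < 1) (n : ℕ) : qPoch a q n ≠ 0 :=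
  Finset.prod_ne_zero_iff.2 fun k _ => one_sub_mul_pow_ne_zero hq ha k

/-! ### Infinite products -/

theorem tendsto_qPoch (a : ℂ) {q : ℂ} (hq : ‖q‖ < 1) :
    Filter.Tendsto (qPoch a q) Filter.atTop (nhds (qPochInf a q)) :=
  (multipliable_qPochInf a hq).hasProd.tendsto_prod_nat

theorem qPochInf_ne_zero {q a : ℂ} (hq : ‖q‖ < 1) (ha : ‖a‖ < 1) : qPochInf a q ≠ 0 := by
  have h : Summable (fun k : ℕ => ‖-(a * q ^ k)‖) := by
    simpa [norm_mul, norm_pow] using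
      (summable_geometric_of_lt_one (norm_nonneg q) hq).mul_left ‖a‖
  have := tprod_one_add_ne_zero_of_summable (f := fun k : ℕ => -(a * q ^ k))
    (fun k => by simpa [sub_eq_add_neg] using one_sub_mul_pow_ne_zero hq ha k) h
  simpa [qPochInf, sub_eq_add_neg] using this

theorem qPochInf_zero_left (q : ℂ) : qPochInf 0 q = 1 := by
  simp [qPochInf]

theorem qPochInf_eq_mul (a : ℂ) {q : ℂ} (hq : ‖q‖ < 1) :
    qPochInf a q = (1 - a) * qPochInf (a * q) q := by
  refine tendsto_nhds_unique
    ((tendsto_qPoch a hq).comp (Filter.tendsto_add_atTop_nat 1)) ?_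
  refine ((tendsto_qPoch (a * q) hq).const_mul (1 - a)).congr fun n => ?_
  exact qPoch_mul_self a q n

/-- Splitting the factors by the parity of the exponent. -/
theorem qPochInf_eq_even_mul_odd (a : ℂ) {q : ℂ} (hq : ‖q‖ < 1) :
    qPochInf a q = qPochInf a (q ^ 2) * qPochInf (a * q) (q ^ 2) := by
  have hq2 : ‖q ^ 2‖ < 1 := by
    rw [norm_pow]; exact pow_lt_one₀ (norm_nonneg q) hq two_ne_zero
  have he : (fun k : ℕ => 1 - a * (q ^ 2) ^ k) = fun k => 1 - a * q ^ (2 * k) := by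
    funext k; rw [pow_mul]
  have ho : (fun k : ℕ => 1 - a * q * (q ^ 2) ^ k) = fun k => 1 - a * q ^ (2 * k + 1) := by
    funext k; rw [← pow_mul]; ring
  have h1 := multipliable_qPochInf a hq2
  have h2 := multipliable_qPochInf (a * q) hq2
  rw [he] at h1
  rw [ho] at h2
  unfold qPochInf
  rw [he, ho]
  exact (tprod_even_mul_odd (f := fun k => 1 - a * q ^ k) h1 h2).symm

theorem qPochInf_neg_mul (a : ℂ) {q : ℂ} (hq : ‖q‖ < 1) :
    qPochInf (-a) q * qPochInf a q = qPochInf (a ^ 2) (q ^ 2) := by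
  unfold qPochInf
  rw [← (multipliable_qPochInf (-a) hq).tprod_mul (multipliable_qPochInf a hq)]
  refine tprod_congr fun k => ?_
  ring

/-! ### Uniform estimates -/

theorem norm_shiftedPow_le {q : ℂ} (hq : ‖q‖ < 1) {r : ℝ} (hr : 0 < r) :
    ∃ C : ℝ, 0 ≤ C ∧ ∀ a : ℂ, ‖a‖ ≤ r → ∀ n, ‖shiftedPow a q n‖ ≤ C * r ^ n := by
  refine ⟨Real.exp (∑' k : ℕ, ‖q‖ ^ k * (‖q‖ / r)), (Real.exp_pos _).le, fun a ha n => ?_⟩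
  have hs : Summable fun k : ℕ => ‖q‖ ^ k * (‖q‖ / r) :=
    (summable_geometric_of_lt_one (norm_nonneg q) hq).mul_right _
  calc ‖shiftedPow a q n‖ = ∏ k ∈ Finset.range n, ‖a - q ^ (k + 1)‖ := norm_prod _ _
    _ ≤ ∏ k ∈ Finset.range n, (Real.exp (‖q‖ ^ k * (‖q‖ / r)) * r) := by
        refine Finset.prod_le_prod (fun _ _ => norm_nonneg _) fun k _ => ?_
        have h1 : ‖a - q ^ (k + 1)‖ ≤ r + ‖q‖ ^ (k + 1) := by
          refine (norm_sub_le _ _).trans ?_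
          rw [norm_pow]
          gcongr
        have h2 : r + ‖q‖ ^ (k + 1) = (‖q‖ ^ k * (‖q‖ / r) + 1) * r := by
          field_simp
          ring
        rw [h2] at h1
        exact h1.trans (mul_le_mul_of_nonneg_right (Real.add_one_le_exp _) hr.le)
    _ = Real.exp (∑ k ∈ Finset.range n, ‖q‖ ^ k * (‖q‖ / r)) * r ^ n := by
        rw [Finset.prod_mul_distrib, Real.exp_sum, Finset.prod_const, Finset.card_range]
    _ ≤ _ := by
        gcongr
        exact hs.sum_le_tsum _ fun k _ => by positivity

theorem norm_inv_qPoch_le {q : ℂ} (hq : ‖q‖ < 1) {r : ℝ} (hr : 0 < r) (hr1 : r < 1) :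
    ∃ C : ℝ, 0 ≤ C ∧ ∀ b : ℂ, ‖b‖ ≤ r → ∀ n, ‖(qPoch b q n)⁻¹‖ ≤ C := by
  refine ⟨Real.exp (∑' k : ℕ, ‖q‖ ^ k * (r / (1 - r))), (Real.exp_pos _).le, fun b hb n => ?_⟩
  have h1r : 0 < 1 - r := sub_pos.2 hr1
  have hs : Summable fun k : ℕ => ‖q‖ ^ k * (r / (1 - r)) :=
    (summable_geometric_of_lt_one (norm_nonneg q) hq).mul_right _
  calc ‖(qPoch b q n)⁻¹‖ = ∏ k ∈ Finset.range n, ‖1 - b * q ^ k‖⁻¹ := by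
        rw [norm_inv, qPoch, norm_prod, Finset.prod_inv_distrib]
    _ ≤ ∏ k ∈ Finset.range n, Real.exp (‖q‖ ^ k * (r / (1 - r))) := by
        refine Finset.prod_le_prod (fun _ _ => by positivity) fun k _ => ?_
        set t := ‖q‖ ^ k with ht
        have ht0 : 0 ≤ t := by positivity
        have ht1 : t ≤ 1 := pow_le_one₀ (norm_nonneg q) hq.le
        have h2 : 1 - r * t ≤ ‖1 - b * q ^ k‖ := by
          have := norm_sub_norm_le (1 : ℂ) (b * q ^ k)
          rw [norm_one, norm_mul, norm_pow, ← ht] at this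
          nlinarith
        have h3 : 0 < 1 - r * t := by nlinarith
        -- `1 / (1 - rt) ≤ 1 + rt / (1 - r)` because `t ≤ 1`
        have h4 : (1 - r * t)⁻¹ ≤ t * (r / (1 - r)) + 1 := by
          rw [inv_le_iff_one_le_mul₀ h3]
          have : (t * (r / (1 - r)) + 1) * (1 - r * t) - 1 = r * t * (r * (1 - t)) / (1 - r) := by
            field_simp
            ring
          have h5 : 0 ≤ r * t * (r * (1 - t)) / (1 - r) :=
            div_nonneg (mul_nonneg (by positivity) (mul_nonneg hr.le (sub_nonneg.2 ht1))) h1r.le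
          linarith
        exact (inv_anti₀ h3 h2).trans (h4.trans (Real.add_one_le_exp _))
    _ = Real.exp (∑ k ∈ Finset.range n, ‖q‖ ^ k * (r / (1 - r))) := (Real.exp_sum _ _).symm
    _ ≤ _ := by
        gcongr
        exact hs.sum_le_tsum _ fun k _ => by positivity

/-- The terms are dominated by a geometric sequence, uniformly for `‖a‖, ‖b‖ ≤ r < 1`. -/
theorem norm_term_le {q : ℂ} (hq : ‖q‖ < 1) {r : ℝ} (hr : 0 < r) (hr1 : r < 1) :
    ∃ C : ℝ, ∀ a b : ℂ, ‖a‖ ≤ r → ‖b‖ ≤ r → ∀ n, ‖term q a b n‖ ≤ C * r ^ n := by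
  obtain ⟨C₁, hC₁, h₁⟩ := norm_shiftedPow_le hq hr
  obtain ⟨C₂, hC₂, h₂⟩ := norm_inv_qPoch_le hq hr hr1
  refine ⟨C₁ * C₂, fun a b ha hb n => ?_⟩
  rw [term, div_eq_mul_inv, norm_mul, mul_right_comm]
  exact mul_le_mul (h₁ a ha n) (h₂ b hb (n + 1)) (norm_nonneg _) (by positivity)

theorem summable_geometric_bound (C : ℝ) {r : ℝ} (hr : 0 < r) (hr1 : r < 1) :
    Summable fun n : ℕ => C * r ^ n :=
  (summable_geometric_of_lt_one hr.le hr1).mul_left C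

theorem summable_weighted_bound (C : ℝ) {r : ℝ} (hr : 0 < r) (hr1 : r < 1) :
    Summable fun n : ℕ => (n : ℝ) * (C * r ^ n) := by
  have h := summable_pow_mul_geometric_of_norm_lt_one 1 (r := r)
    (by rwa [Real.norm_of_nonneg hr.le])
  exact (h.mul_left C).congr fun n => by ring

theorem exists_radius {a b : ℂ} (ha : ‖a‖ < 1) (hb : ‖b‖ < 1) :
    ∃ r : ℝ, 0 < r ∧ r < 1 ∧ ‖a‖ < r ∧ ‖b‖ < r := by
  obtain ⟨r, h1, h2⟩ := exists_between (max_lt ha hb)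
  have h3 := (le_max_left _ _).trans_lt h1
  exact ⟨r, (norm_nonneg a).trans_lt h3, h2, h3, (le_max_right _ _).trans_lt h1⟩

theorem summable_term {q a b : ℂ} (hq : ‖q‖ < 1) (ha : ‖a‖ < 1) (hb : ‖b‖ < 1) :
    Summable (term q a b) := by
  obtain ⟨r, hr, hr1, har, hbr⟩ := exists_radius ha hb
  obtain ⟨C, hC⟩ := norm_term_le hq hr hr1
  exact (summable_geometric_bound C hr hr1).of_norm_bounded (hC a b har.le hbr.le)

theorem norm_weighted_le {z : ℂ} {c : ℝ} (n : ℕ) (h : ‖z‖ ≤ c) : ‖(n : ℂ) * z‖ ≤ n * c := by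
  rw [norm_mul, Complex.norm_natCast]
  gcongr

theorem summable_weighted {q a b : ℂ} (hq : ‖q‖ < 1) (ha : ‖a‖ < 1) (hb : ‖b‖ < 1) :
    Summable fun n : ℕ => (n : ℂ) * term q a b n := by
  obtain ⟨r, hr, hr1, har, hbr⟩ := exists_radius ha hb
  obtain ⟨C, hC⟩ := norm_term_le hq hr hr1
  exact (summable_weighted_bound C hr hr1).of_norm_bounded
    fun n => norm_weighted_le n (hC a b har.le hbr.le n)

/-! ### Continuity at the origin -/

theorem continuousAt_of_term {q a : ℂ} (hq : ‖q‖ < 1) (ha : ‖a‖ < 1) :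
    ContinuousAt (termSum q a) 0 ∧ ContinuousAt (fun b => termSum q b a) 0 ∧
      ContinuousAt (weightedSum q a) 0 ∧ ContinuousAt (fun b => weightedSum q b a) 0 := by
  obtain ⟨r, hr, hr1, har, -⟩ := exists_radius ha ha
  obtain ⟨C, hC⟩ := norm_term_le hq hr hr1
  have hmem : Metric.closedBall (0 : ℂ) r ∈ nhds 0 := Metric.closedBall_mem_nhds 0 hr
  have hnorm : ∀ b ∈ Metric.closedBall (0 : ℂ) r, ‖b‖ ≤ r := fun b hb => by simpa using hb
  have hc₁ : ∀ n, ContinuousOn (fun b => term q a b n) (Metric.closedBall 0 r) := fun n => by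
    refine ContinuousOn.div₀ continuousOn_const ?_ fun b hb =>
      qPoch_ne_zero hq ((hnorm b hb).trans_lt hr1) _
    unfold qPoch
    fun_prop
  have hc₂ : ∀ n, ContinuousOn (fun b => term q b a n) (Metric.closedBall 0 r) := fun n => by
    unfold term shiftedPow
    fun_prop
  refine ⟨?_, ?_, ?_, ?_⟩
  · exact (continuousOn_tsum hc₁ (summable_geometric_bound C hr hr1)
      fun n b hb => hC a b har.le (hnorm b hb) n).continuousAt hmem
  · exact (continuousOn_tsum hc₂ (summable_geometric_bound C hr hr1)
      fun n b hb => hC b a (hnorm b hb) har.le n).continuousAt hmem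
  · exact (continuousOn_tsum (fun n => continuousOn_const.mul (hc₁ n))
      (summable_weighted_bound C hr hr1)
      fun n b hb => norm_weighted_le n (hC a b har.le (hnorm b hb) n)).continuousAt hmem
  · exact (continuousOn_tsum (fun n => continuousOn_const.mul (hc₂ n))
      (summable_weighted_bound C hr hr1)
      fun n b hb => norm_weighted_le n (hC b a (hnorm b hb) har.le n)).continuousAt hmem

theorem continuousAt_antiSum {q a : ℂ} (hq : ‖q‖ < 1) (ha : ‖a‖ < 1) :
    ContinuousAt (antiSum q a) 0 := by
  obtain ⟨h₁, h₂, -, -⟩ := continuousAt_of_term hq ha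
  exact h₁.sub h₂

theorem continuousAt_fullSum {q a : ℂ} (hq : ‖q‖ < 1) (ha : ‖a‖ < 1) :
    ContinuousAt (fullSum q a) 0 := by
  obtain ⟨-, h₂, h₃, h₄⟩ := continuousAt_of_term hq ha
  exact h₃.add (h₄.add h₂)

/-! ### Contiguous relations -/

theorem term_zero (q a b : ℂ) : term q a b 0 = (1 - b)⁻¹ := by
  simp [term, shiftedPow, qPoch]

/-- Multiplying the second parameter by `q`: the new terms are differences that nearly telescope. -/
theorem term_mul_right {q a b : ℂ} (hq : ‖q‖ < 1) (hb : ‖b‖ < 1) (n : ℕ) :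
    (1 - a * b) * term q a (b * q) n = (1 - b) * (term q a b n - b * term q a b (n + 1)) := by
  have h0 := one_sub_ne_zero_of_norm_lt hb
  have h1 := one_sub_mul_pow_ne_zero hq hb (n + 1)
  have h2 := qPoch_ne_zero hq hb (n + 1)
  have h3 : qPoch (b * q) q (n + 1) = qPoch b q (n + 1) * (1 - b * q ^ (n + 1)) / (1 - b) := by
    rw [eq_div_iff h0, mul_comm, qPoch_mul_self, qPoch_succ]
  rw [term, term, term, h3, qPoch_succ b q (n + 1), shiftedPow_succ]
  field_simp
  ring

/-- Multiplying the first parameter by `q`. Compared with `term_mul_right`, consecutive terms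
change places in the difference; the boundary term at `n = 0` compensates for this, so that the
sums obey one common equation (`termSum_mul_right`, `termSum_mul_left`). -/
theorem term_mul_left {q a b : ℂ} (hq : ‖q‖ < 1) (ha : ‖a‖ < 1) (n : ℕ) :
    (1 - a * b) * term q (b * q) a (n + 1) =
      (1 - b) * (term q b a (n + 1) - b * term q b a n) := by
  have h1 := one_sub_mul_pow_ne_zero hq ha (n + 1)
  have h2 := qPoch_ne_zero hq ha (n + 1)
  rw [term, term, term, qPoch_succ a q (n + 1), shiftedPow_mul_self, shiftedPow_succ]
  field_simp
  ring

theorem hasSum_term_succ {q a b : ℂ} (hq : ‖q‖ < 1) (ha : ‖a‖ < 1) (hb : ‖b‖ < 1) :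
    HasSum (fun n => term q a b (n + 1)) (termSum q a b - (1 - b)⁻¹) := by
  have := (hasSum_nat_add_iff' 1).2 (summable_term hq ha hb).hasSum
  rwa [Finset.sum_range_one, term_zero] at this

theorem hasSum_weighted_succ {q a b : ℂ} (hq : ‖q‖ < 1) (ha : ‖a‖ < 1) (hb : ‖b‖ < 1) :
    HasSum (fun n : ℕ => ((n : ℂ) + 1) * term q a b (n + 1)) (weightedSum q a b) := by
  have := (hasSum_nat_add_iff' 1).2 (summable_weighted hq ha hb).hasSum
  rw [Finset.sum_range_one, Nat.cast_zero, zero_mul, sub_zero] at this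
  exact this.congr_fun fun n => by rw [Nat.cast_succ]

theorem termSum_mul_right {q a b : ℂ} (hq : ‖q‖ < 1) (ha : ‖a‖ < 1) (hb : ‖b‖ < 1) :
    (1 - a * b) * termSum q a (b * q) = (1 - b) ^ 2 * termSum q a b + b := by
  have hbq : ‖b * q‖ < 1 := by simpa using norm_mul_pow_lt_one hq hb 1
  have h1 := (summable_term hq ha hbq).hasSum.mul_left (1 - a * b)
  have h2 := ((summable_term hq ha hb).hasSum.sub
    ((hasSum_term_succ hq ha hb).mul_left b)).mul_left (1 - b)
  have h3 := h1.unique (h2.congr_fun fun n => term_mul_right hq hb n)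
  have h0 := one_sub_ne_zero_of_norm_lt hb
  change (1 - a * b) * termSum q a (b * q) =
    (1 - b) * (termSum q a b - b * (termSum q a b - (1 - b)⁻¹)) at h3
  rw [h3]
  field_simp
  ring

theorem termSum_mul_left {q a b : ℂ} (hq : ‖q‖ < 1) (ha : ‖a‖ < 1) (hb : ‖b‖ < 1) :
    (1 - a * b) * termSum q (b * q) a = (1 - b) ^ 2 * termSum q b a + b := by
  have hbq : ‖b * q‖ < 1 := by simpa using norm_mul_pow_lt_one hq hb 1
  have h1 := (hasSum_term_succ hq hbq ha).mul_left (1 - a * b)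
  have h2 := ((hasSum_term_succ hq hb ha).sub
    ((summable_term hq hb ha).hasSum.mul_left b)).mul_left (1 - b)
  have h3 := h1.unique (h2.congr_fun fun n => term_mul_left hq ha n)
  have h0 := mul_inv_cancel₀ (one_sub_ne_zero_of_norm_lt ha)
  change _ = (1 - b) * (termSum q b a - (1 - a)⁻¹ - b * termSum q b a) at h3
  linear_combination h3 + b * h0

theorem weightedSum_mul_right {q a b : ℂ} (hq : ‖q‖ < 1) (ha : ‖a‖ < 1) (hb : ‖b‖ < 1) :
    (1 - a * b) * weightedSum q a (b * q) =
      (1 - b) ^ 2 * weightedSum q a b + b * (1 - b) * termSum q a b - b := by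
  have hbq : ‖b * q‖ < 1 := by simpa using norm_mul_pow_lt_one hq hb 1
  have h1 := (summable_weighted hq ha hbq).hasSum.mul_left (1 - a * b)
  have h2 := ((summable_weighted hq ha hb).hasSum.sub
    (((hasSum_weighted_succ hq ha hb).sub (hasSum_term_succ hq ha hb)).mul_left b)).mul_left (1 - b)
  have h3 := h1.unique (h2.congr_fun fun n => by
    linear_combination (n : ℂ) * term_mul_right (a := a) hq hb n)
  have h0 := one_sub_ne_zero_of_norm_lt hb
  change (1 - a * b) * weightedSum q a (b * q) = (1 - b) *
    (weightedSum q a b - b * (weightedSum q a b - (termSum q a b - (1 - b)⁻¹))) at h3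
  rw [h3]
  field_simp
  ring

theorem weightedSum_mul_left {q a b : ℂ} (hq : ‖q‖ < 1) (ha : ‖a‖ < 1) (hb : ‖b‖ < 1) :
    (1 - a * b) * (weightedSum q (b * q) a + termSum q (b * q) a) =
      (1 - b) ^ 2 * (weightedSum q b a + termSum q b a) - b * (1 - b) * termSum q b a + b := by
  have hbq : ‖b * q‖ < 1 := by simpa using norm_mul_pow_lt_one hq hb 1
  have h1 := (hasSum_weighted_succ hq hbq ha).mul_left (1 - a * b)
  have h2 := ((hasSum_weighted_succ hq hb ha).sub
    (((summable_weighted hq hb ha).hasSum.add (summable_term hq hb ha).hasSum).mul_left b)).mul_left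
      (1 - b)
  have h3 := h1.unique (h2.congr_fun fun n => by
    linear_combination ((n : ℂ) + 1) * term_mul_left (b := b) hq ha n)
  change _ = (1 - b) * (weightedSum q b a - b * (weightedSum q b a + termSum q b a)) at h3
  linear_combination h3 + termSum_mul_left hq ha hb

/-! ### Iterating a first-order `q`-difference equation -/

/-- A solution of `(1 - b)² Φ(b) = (1 - ab) Φ(bq)` that is continuous at `0` is determined by
its value at `0`. -/
theorem qPochInf_sq_mul_eq {q a : ℂ} (hq : ‖q‖ < 1) {Φ : ℂ → ℂ}
    (hΦ : ∀ b, ‖b‖ < 1 → (1 - b) ^ 2 * Φ b = (1 - a * b) * Φ (b * q))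
    (h0 : ContinuousAt Φ 0) {b : ℂ} (hb : ‖b‖ < 1) :
    qPochInf b q ^ 2 * Φ b = qPochInf (a * b) q * Φ 0 := by
  have hiter : ∀ N, qPoch b q N ^ 2 * Φ b = qPoch (a * b) q N * Φ (b * q ^ N) := fun N => by
    induction N with
    | zero => simp [qPoch]
    | succ N ih =>
      have := hΦ _ (norm_mul_pow_lt_one hq hb N)
      rw [qPoch_succ, qPoch_succ, pow_succ q, ← mul_assoc b]
      linear_combination (1 - b * q ^ N) ^ 2 * ih + qPoch (a * b) q N * this
  have hlim : Filter.Tendsto (fun N : ℕ => b * q ^ N) Filter.atTop (nhds 0) := by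
    simpa using (tendsto_pow_atTop_nhds_zero_of_norm_lt_one hq).const_mul b
  exact tendsto_nhds_unique (((tendsto_qPoch b hq).pow 2).mul_const _)
    (((tendsto_qPoch (a * b) hq).mul (h0.tendsto.comp hlim)).congr fun N => (hiter N).symm)

/-! ### Reciprocity and evaluation of the full series -/

/-- Reciprocity: `∑ (q/a; q)_n a^n / (b; q)_{n+1}` is symmetric in `a` and `b`. The difference
`D(a, b)` of the two sides satisfies `(b; q)_∞² D(a, b) = (ab; q)_∞ D(a, 0)`, and `D(a, a) = 0`
forces `D(a, 0) = 0`. -/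
theorem termSum_comm {q a b : ℂ} (hq : ‖q‖ < 1) (ha : ‖a‖ < 1) (hb : ‖b‖ < 1) :
    termSum q a b = termSum q b a := by
  have key : ∀ b, ‖b‖ < 1 →
      qPochInf b q ^ 2 * antiSum q a b = qPochInf (a * b) q * antiSum q a 0 := fun b hb =>
    qPochInf_sq_mul_eq hq (fun b hb => by
      unfold antiSum
      linear_combination termSum_mul_left hq ha hb - termSum_mul_right hq ha hb)
      (continuousAt_antiSum hq ha) hb
  have haa : ‖a * a‖ < 1 := by
    rw [norm_mul]; exact mul_lt_one_of_nonneg_of_lt_one_left (norm_nonneg a) ha ha.le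
  have h0 : antiSum q a 0 = 0 := by
    have := key a ha
    rw [show antiSum q a a = 0 from sub_self _, mul_zero, eq_comm] at this
    exact (mul_eq_zero.1 this).resolve_left (qPochInf_ne_zero hq haa)
  have := key b hb
  rw [h0, mul_zero] at this
  exact sub_eq_zero.1 ((mul_eq_zero.1 this).resolve_left
    (pow_ne_zero 2 (qPochInf_ne_zero hq hb)))

theorem fullSum_comm {q a b : ℂ} (hq : ‖q‖ < 1) (ha : ‖a‖ < 1) (hb : ‖b‖ < 1) :
    fullSum q a b = fullSum q b a := by
  unfold fullSum
  linear_combination -termSum_comm hq ha hb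

/-- The weighted relations leave a defect `b (1 - b) D(a, b)`, which vanishes by reciprocity. -/
theorem qPochInf_sq_mul_fullSum {q a b : ℂ} (hq : ‖q‖ < 1) (ha : ‖a‖ < 1) (hb : ‖b‖ < 1) :
    qPochInf b q ^ 2 * fullSum q a b = qPochInf (a * b) q * fullSum q a 0 := by
  refine qPochInf_sq_mul_eq hq (fun b hb => ?_) (continuousAt_fullSum hq ha) hb
  unfold fullSum
  linear_combination -weightedSum_mul_right hq ha hb - weightedSum_mul_left hq ha hb
    + -b * (1 - b) * termSum_comm hq ha hb

/-- Up to an explicit product, the full series is its value at `a = b = 0`. -/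
theorem fullSum_eq_mul_fullSum_zero {q a b : ℂ} (hq : ‖q‖ < 1) (ha : ‖a‖ < 1) (hb : ‖b‖ < 1) :
    qPochInf a q ^ 2 * qPochInf b q ^ 2 * fullSum q a b =
      qPochInf (a * b) q * fullSum q 0 0 := by
  have h0 : ‖(0 : ℂ)‖ < 1 := by simp
  have h1 := qPochInf_sq_mul_fullSum hq ha hb
  have h2 := qPochInf_sq_mul_fullSum hq h0 ha
  rw [fullSum_comm hq h0 ha, zero_mul, qPochInf_zero_left, one_mul] at h2
  linear_combination qPochInf a q ^ 2 * h1 + qPochInf (a * b) q * h2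

theorem term_self_left_succ (q b : ℂ) (n : ℕ) : term q q b (n + 1) = 0 := by
  have : shiftedPow q q (n + 1) = 0 :=
    Finset.prod_eq_zero (Finset.mem_range.2 n.succ_pos) (by simp)
  rw [term, this, zero_div]

/-- At `a = b = q` only the term `n = 0` survives. -/
theorem fullSum_self (q : ℂ) : fullSum q q q = (1 - q)⁻¹ := by
  have h1 : weightedSum q q q = 0 := by
    rw [weightedSum, tsum_eq_single 0]
    · simp
    · intro n hn
      obtain ⟨m, rfl⟩ := Nat.exists_eq_succ_of_ne_zero hn
      simp [term_self_left_succ]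
  have h2 : termSum q q q = (1 - q)⁻¹ := by
    rw [termSum, tsum_eq_single 0, term_zero]
    intro n hn
    obtain ⟨m, rfl⟩ := Nat.exists_eq_succ_of_ne_zero hn
    exact term_self_left_succ q q m
  rw [fullSum, h1, h2, zero_add, zero_add]

/-- The value at the origin, which is Jacobi's identity; it is read off from `a = b = q`. -/
theorem fullSum_zero {q : ℂ} (hq : ‖q‖ < 1) : fullSum q 0 0 = qPochInf q q ^ 3 := by
  have h := fullSum_eq_mul_fullSum_zero hq hq hq
  have hq0 := qPochInf_ne_zero hq hq
  have h1 := one_sub_ne_zero_of_norm_lt hq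
  have h2 := qPochInf_eq_mul q hq
  have h3 : qPochInf (q * q) q ≠ 0 := fun h0 => hq0 (by rw [h2, h0, mul_zero])
  rw [fullSum_self] at h
  apply mul_left_cancel₀ h3
  rw [← h, ← div_eq_mul_inv, div_eq_iff h1]
  linear_combination qPochInf q q ^ 3 * h2

theorem fullSum_eq {q a b : ℂ} (hq : ‖q‖ < 1) (ha : ‖a‖ < 1) (hb : ‖b‖ < 1) :
    fullSum q a b =
      qPochInf q q ^ 3 * qPochInf (a * b) q / (qPochInf a q ^ 2 * qPochInf b q ^ 2) := by
  have ha0 := qPochInf_ne_zero hq ha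
  have hb0 := qPochInf_ne_zero hq hb
  rw [eq_div_iff (by positivity), ← fullSum_zero hq]
  linear_combination fullSum_eq_mul_fullSum_zero hq ha hb

/-! ### The series identities -/

theorem hasSum_succ_mul_term {q a b : ℂ} (hq : ‖q‖ < 1) (ha : ‖a‖ < 1) (hb : ‖b‖ < 1) :
    HasSum (fun n : ℕ => ((n : ℂ) + 1) * term q a b n) (weightedSum q a b + termSum q a b) :=
  ((summable_weighted hq ha hb).hasSum.add (summable_term hq ha hb).hasSum).congr_fun
    fun n => by ring

/-- The two-variable identity in polynomial form, so that `a` and `b` may vanish. -/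
theorem hasSum_fullSum {q a b : ℂ} (hq : ‖q‖ < 1) (ha : ‖a‖ < 1) (hb : ‖b‖ < 1) :
    HasSum (fun n : ℕ => (n : ℂ) * term q a b n + ((n : ℂ) + 1) * term q b a n)
      (qPochInf q q ^ 3 * qPochInf (a * b) q / (qPochInf a q ^ 2 * qPochInf b q ^ 2)) := by
  rw [← fullSum_eq hq ha hb]
  exact (summable_weighted hq ha hb).hasSum.add (hasSum_succ_mul_term hq hb ha)

theorem hasSum_diagonal {q a : ℂ} (hq : ‖q‖ < 1) (ha : ‖a‖ < 1) :
    HasSum (fun n : ℕ => (2 * (n : ℂ) + 1) * term q a a n)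
      (qPochInf q q ^ 3 * qPochInf (a ^ 2) q / qPochInf a q ^ 4) := by
  have h := hasSum_fullSum hq ha ha
  rw [← sq, ← pow_add] at h
  exact h.congr_fun fun n => by ring

theorem hasSum_jacobi {q : ℂ} (hq : ‖q‖ < 1) :
    HasSum (fun n : ℕ => (2 * (n : ℂ) + 1) * (-1) ^ n * q ^ Nat.choose (n + 1) 2)
      (qPochInf q q ^ 3) := by
  have h := hasSum_diagonal hq (a := 0) (by simp)
  rw [zero_pow two_ne_zero, qPochInf_zero_left, one_pow, mul_one, div_one] at h
  refine h.congr_fun fun n => ?_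
  simp [term, shiftedPow_zero_left, qPoch, mul_assoc]

/-- For `ab = q` the quotient of shifted factorials collapses to a single factor. -/
theorem term_of_mul_eq {q a b : ℂ} (hq : ‖q‖ < 1) (ha : a ≠ 0) (hb : ‖b‖ < 1) (hab : a * b = q)
    (n : ℕ) : term q a b n = a ^ n / (1 - b * q ^ n) := by
  have h := qPoch_ne_zero hq hb n
  rw [term, ← shiftedPow_eq ha, qPoch_succ, ← hab, mul_div_cancel_left₀ _ ha, hab,
    mul_div_mul_left _ _ h]

/-- The bilateral Lambert series: the case `ab = q` of the two-variable identity, whose two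
halves supply the nonnegative and the negative indices. -/
theorem hasSum_bilateral {q b : ℂ} (hq0 : q ≠ 0) (hqb : ‖q‖ < ‖b‖) (hb : ‖b‖ < 1) :
    HasSum (fun n : ℤ => (n : ℂ) * b ^ n / (1 - q ^ (n + 1) / b))
      (qPochInf q q ^ 4 / (qPochInf b q ^ 2 * qPochInf (q / b) q ^ 2)) := by
  have hq : ‖q‖ < 1 := hqb.trans hb
  have hb0 : b ≠ 0 := norm_pos_iff.1 ((norm_nonneg q).trans_lt hqb)
  have hqb0 : q / b ≠ 0 := div_ne_zero hq0 hb0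
  have hc : ‖q / b‖ < 1 := by
    rw [norm_div]; exact (div_lt_one (norm_pos_iff.2 hb0)).2 hqb
  have hmul : b * (q / b) = q := mul_div_cancel₀ q hb0
  have hval := fullSum_eq hq hb hc
  rw [hmul, ← pow_succ] at hval
  rw [← hval]
  refine HasSum.of_nat_of_neg_add_one ?_ ?_
  · refine (summable_weighted hq hb hc).hasSum.congr_fun fun n => ?_
    rw [term_of_mul_eq hq hb0 hc hmul, ← mul_div_assoc]
    norm_cast
    rw [pow_succ', div_mul_eq_mul_div]
  · refine (hasSum_succ_mul_term hq hc hb).congr_fun fun n => ?_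
    have h1 := one_sub_mul_pow_ne_zero hq hb n
    have h2 : 1 - q ^ (-((n : ℤ) + 1) + 1) / b = -(1 - b * q ^ n) / (b * q ^ n) := by
      rw [show -((n : ℤ) + 1) + 1 = -(n : ℤ) by ring, zpow_neg, zpow_natCast]
      field_simp
      ring
    rw [term_of_mul_eq hq hqb0 hb ((mul_comm _ _).trans hmul), h2, zpow_neg]
    norm_cast
    push_cast
    rw [div_pow, pow_succ]
    field_simp

/-- The factors of `(q²; q²)_∞` with exponent divisible by four give `(q⁴; q⁴)_∞`, and the others
give `(q²; q⁴)_∞ = (-q; q²)_∞ (q; q²)_∞`. -/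
theorem qPochInf_lambert_product {q : ℂ} (hq : ‖q‖ < 1) :
    qPochInf (q ^ 2) (q ^ 2) =
      qPochInf (-q) (q ^ 2) * (qPochInf q (q ^ 2) * qPochInf (q ^ 4) (q ^ 4)) := by
  have hq2 : ‖q ^ 2‖ < 1 := by
    rw [norm_pow]; exact pow_lt_one₀ (norm_nonneg q) hq two_ne_zero
  rw [qPochInf_eq_even_mul_odd (q ^ 2) hq2, ← mul_assoc, qPochInf_neg_mul q hq2, ← pow_mul,
    ← pow_add]

end LambertSeries

open LambertSeries in
theorem mainTheorem5 (q : ℂ) (hq : ‖q‖ < 1) :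
    (∀ a b : ℂ, a ≠ 0 → b ≠ 0 → ‖a‖ < 1 → ‖b‖ < 1 →
      HasSum
        (fun n : ℕ =>
          (n : ℂ) * qPoch (q / a) q n * a ^ n / qPoch b q (n + 1)
            + ((n : ℂ) + 1) * qPoch (q / b) q n * b ^ n / qPoch a q (n + 1))
        (qPochInf q q ^ 3 * qPochInf (a * b) q
          / (qPochInf a q ^ 2 * qPochInf b q ^ 2))) ∧
    (∀ a : ℂ, a ≠ 0 → ‖a‖ < 1 →
      HasSum
        (fun n : ℕ => (2 * (n : ℂ) + 1) * (qPoch (q / a) q n * a ^ n / qPoch a q (n + 1)))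
        (qPochInf q q ^ 3 * qPochInf (a ^ 2) q / qPochInf a q ^ 4)) ∧
    HasSum
      (fun n : ℕ => (2 * (n : ℂ) + 1) * (-1) ^ n * q ^ (Nat.choose (n + 1) 2))
      (qPochInf q q ^ 3) ∧
    (∀ b : ℂ, 0 < ‖q‖ → ‖q‖ < ‖b‖ → ‖b‖ < 1 →
      HasSum
        (fun n : ℤ => (n : ℂ) * b ^ n / (1 - q ^ (n + 1) / b))
        (qPochInf q q ^ 4 / (qPochInf b q ^ 2 * qPochInf (q / b) q ^ 2))) ∧
    (0 < ‖q‖ →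
      HasSum
        (fun n : ℤ => (n : ℂ) * (-q) ^ n / (1 + q ^ (2 * n + 1)))
        (qPochInf q (q ^ 2) ^ 4 * qPochInf (q ^ 4) (q ^ 4) ^ 4)) := by
  refine ⟨fun a b ha0 hb0 ha hb => ?_, fun a ha0 ha => ?_, hasSum_jacobi hq,
    fun b hq0 hqb hb => hasSum_bilateral (norm_pos_iff.1 hq0) hqb hb, fun hq0 => ?_⟩
  · refine (hasSum_fullSum hq ha hb).congr_fun fun n => ?_
    rw [term, term, mul_assoc, mul_assoc, shiftedPow_eq ha0, shiftedPow_eq hb0, mul_div_assoc,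
      mul_div_assoc]
  · refine (hasSum_diagonal hq ha).congr_fun fun n => ?_
    rw [term, shiftedPow_eq ha0]
  · have hq0' : q ≠ 0 := norm_pos_iff.1 hq0
    have hq2 : ‖q ^ 2‖ < ‖-q‖ := by
      rw [norm_pow, norm_neg, sq]
      exact mul_lt_of_lt_one_left hq0 hq
    have hnq : ‖-q‖ < 1 := by rwa [norm_neg]
    have h := hasSum_bilateral (pow_ne_zero 2 hq0') hq2 hnq
    have hne := qPochInf_ne_zero (hq2.trans hnq) hnq
    have hdiv : q ^ 2 / -q = -q := by field_simp
    rw [hdiv, qPochInf_lambert_product hq] at h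
    convert h using 1
    · funext n
      have : q ^ (2 * n + 1) = -((q ^ 2) ^ (n + 1) / -q) := by
        rw [← zpow_natCast q 2, ← zpow_mul, div_neg, neg_neg, eq_div_iff hq0',
          ← zpow_add_one₀ hq0']
        congr 1
        push_cast
        ring
      rw [this, ← sub_eq_add_neg]
    · field_simp
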